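/- **Model.** Let $d\ge 1$, and let $L,r,s$ be positive integers with $r-s>1$ and $L\ge 2r$. The $d$-dimensional lattice consists of the $n=L^d$ nodes $\{0,\dots,L-1\}^d\subset\mathbb R^d$. Two nodes are neighbours if their Euclidean distance is greater than $s$ and at most $r$. In a synchronous round each node is a sender or a receiver; a node receives the message in a round if and only if it is not a sender, exactly one of its neighbours is a sender, and no node within distance $s$ of it is a sender. Initially only the source has the message. An algorithm schedules a set of nodes for each round; the scheduled nodes that have the message send it. **Algorithm $\mathcal A$** on a line $0,\dots,L-1$ with source $c$. Put $w=r-(s+1)$, $x=\lceil r/w\rceil$ and $q=c \bmod r$. The scheme $Local^*_k$ has steps $i=0,\dots,x$ of two rounds each: first node $k+iw$ is scheduled, then node $k+iw+r$ (nodes outside the line do not exist). $\mathcal A$ consists of, in this order: (1) the nodes $c,c+r,c+2r,\dots$ and then $c-r,c-2r,\dots$ of the line, one per round; (2) $Local^*_k$ in parallel for $k=q,q+4r,q+8r,\dots$, and then in parallel for $k=q+2r,q+6r,\dots$; (3) the mirror image of $Local^*$ starting at $2r-1$ (nodes $2r-1-iw$, then $r-1-iw$), and then $Local^*_{L-2r}$.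 **Algorithm $\mathcal A^d$** with source $v^0$ has stages $j=0,\dots,d-1$. Stage $0$ executes $\mathcal A$ on the line through $v^0$ parallel to the first axis (coordinate $0$). For $j\ge1$ let $h_j=\lfloor \sqrt3\,r/(2\sqrt j)\rfloor$, and consider the transversal values $h_j,3h_j,5h_j,\dots$ (all of $0,1,\dots,L-1$ if $h_j=0$) up to $L-1$, followed by $L-1$ if it is not among them; number them consecutively from $0$ and divide them into $3j$ classes by their number modulo $3j$. Stage $j$ has $(3j)^j$ phases, one for each choice of a class for each of the coordinates $0,\dots,j-1$; in a phase $\mathcal A$ is executed simultaneously, with source coordinate $v^0_j$, on all lines parallel to axis $j$ whose coordinates $l<j$ lie in the chosen classes and whose coordinates $l>j$ equal $v^0_l$. **Lemma.** For every fixed $d$, Algorithm $\mathcal A^d$ broadcasts in the $d$-dimensional lattice with time complexity in $$\Theta\!\left(d\,\frac{\sqrt[d]{n}}{r}+d\,\frac{r}{r-(s+1)}\right).$$ That is, for every $d\ge1$ there are constants $c,C>0$ depending only on $d$ such that for all $L,r,s$ as above, $n=L^d$, and every source node: all nodes have received the message at the end of $\mathcal A^d$; the number of rounds of $\mathcal A^d$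 is at most $C\,(d\sqrt[d]{n}/r+d\,r/(r-(s+1)))$; and if all nodes have received the message after the first $t$ rounds of $\mathcal A^d$, then $t\ge c\,(d\sqrt[d]{n}/r+d\,r/(r-(s+1)))$. -/

import Mathlib

/-! ### The swamping communication model on the `d`-dimensional lattice -/

/-- The nodes of the `d`-dimensional lattice of side `L`; there are `L ^ d` of them. -/
abbrev LatticeNode (d L : ℕ) : Type := Fin d → Fin L

/-- The location of a node: the integer point of Euclidean space with the same coordinates. -/
noncomputable def LatticeNode.pos {d L : ℕ} (u : LatticeNode d L) : EuclideanSpace ℝ (Fin d) :=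
  WithLp.toLp 2 fun i => ((u i : ℕ) : ℝ)

/-- The communication graph: two nodes share a link when their Euclidean distance is greater than
the swamping distance `s` and at most the communication range `r`. -/
def swampGraph (d L r s : ℕ) : SimpleGraph (LatticeNode d L) where
  Adj u v := (s : ℝ) < dist u.pos v.pos ∧ dist u.pos v.pos ≤ (r : ℝ)
  symm := ⟨fun u v h => by rwa [dist_comm v.pos u.pos]⟩
  loopless := ⟨fun u h => by
    have h1 := h.1
    rw [dist_self] at h1
    exact absurd h1 (not_lt.mpr (Nat.cast_nonneg s))⟩

/-- If `X` is the set of senders of a round, `v` receives the message in that round iff it is not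
itself a sender, exactly one of its neighbours is a sender, and no node within distance `s` of it
is a sender. -/
def Receives {d L : ℕ} (r s : ℕ) (X : Set (LatticeNode d L)) (v : LatticeNode d L) : Prop :=
  v ∉ X ∧ (∃! u, u ∈ X ∧ (swampGraph d L r s).Adj u v) ∧
    ∀ u ∈ X, ¬ dist u.pos v.pos ≤ (s : ℝ)

/-- The nodes that possess the message of the source `src` after the first `t` rounds of a
schedule. In each round the scheduled nodes send the message, provided that they possess it; all
other nodes listen. No node sends once the schedule is over. -/
def informed {d L : ℕ} (r s : ℕ) (sched : List (Set (LatticeNode d L))) (src : LatticeNode d L) :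
    ℕ → Set (LatticeNode d L)
  | 0 => {src}
  | t + 1 => informed r s sched src t ∪
      {v | Receives r s (sched.getD t ∅ ∩ informed r s sched src t) v}

/-! ### Algorithm `A` on the lattice line

A round is given by the set of labels that are scheduled to send; labels that lie outside the
line `0, …, L - 1` belong to no node. -/

/-- The scheme `Local*`, run in parallel from all labels `k ∈ K`. It has `⌈r / (r - (s+1))⌉ + 1`
steps of two rounds: in step `i` first the node at `k + i (r - (s+1))` sends, then the node at
distance `r` further. For `ε = 1` the scheme runs to the right; `ε = -1` is its mirror image. -/
def localScheme (r s : ℕ) (ε : ℤ) (K : Set ℤ) : List (Set ℤ) :=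
  (List.range (r ⌈/⌉ (r - (s + 1)) + 1)).flatMap fun i =>
    [{y | ∃ k ∈ K, y = k + ε * ((i * (r - (s + 1)) : ℕ) : ℤ)},
     {y | ∃ k ∈ K, y = k + ε * ((i * (r - (s + 1)) + r : ℕ) : ℤ)}]

/-- The sparse transmission from label `c`: the labels `c, c + r, c + 2r, …` send one after
another, then the labels `c - r, c - 2r, …`. -/
def sparsePart (L r c : ℕ) : List (Set ℤ) :=
  ((List.range ((L - 1 - c) / r + 1)).map fun j => {((c + j * r : ℕ) : ℤ)}) ++
    ((List.range (c / r)).map fun j => {(c : ℤ) - (((j + 1) * r : ℕ) : ℤ)})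

/-- Algorithm `A` on the line `0, …, L - 1` with source `c`: the sparse transmission; then `Local*`
in parallel from `q, q + 4r, q + 8r, …`, and from `q + 2r, q + 6r, …`, where `q = c % r` is the
leftmost label reached by the sparse transmission; then the termination at the left end (mirrored
`Local*` on the first `2r` labels) and at the right end (`Local*` on the last `2r` labels). -/
def algA (L r s c : ℕ) : List (Set ℤ) :=
  sparsePart L r c ++
    localScheme r s 1 {k | ∃ j : ℕ, k = ((c % r + 4 * r * j : ℕ) : ℤ)} ++
    localScheme r s 1 {k | ∃ j : ℕ, k = ((c % r + 2 * r + 4 * r * j : ℕ) : ℤ)} ++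
    localScheme r s (-1) {2 * (r : ℤ) - 1} ++
    localScheme r s 1 {(L : ℤ) - 2 * (r : ℤ)}

/-! ### Algorithm `A^d` -/

/-- `⌊√3 r / (2 √j)⌋`. A node whose first `j` coordinates differ by at most this number from those
of a line parallel to the next axis has distance at most `√3 r / 2` from that line. -/
def halfGap (r j : ℕ) : ℕ := Nat.sqrt (3 * r ^ 2 / (4 * j))

/-- With `h = halfGap r j`, the lines of a stage have transversal coordinates `h, 3h, 5h, …` (all
of `0, 1, 2, …` if `h = 0`), where the first of these numbers beyond the last coordinate `L - 1`,
if it is needed, is replaced by `L - 1`. They are split cyclically into `3j` classes; this is the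
class `e`. -/
def lineCoords (L r j e : ℕ) : Set ℕ :=
  {z | ∃ m : ℕ, m % (3 * j) = e ∧
    halfGap r j + max 1 (2 * halfGap r j) * m < L - 1 + max 1 (2 * halfGap r j) ∧
    z = min (halfGap r j + max 1 (2 * halfGap r j) * m) (L - 1)}

/-- Algorithm `A^d`. In stage `j = 0, …, d - 1` Algorithm `A` is executed on lines parallel to
axis `j`, inside the sublattice of the nodes that agree with the source in all coordinates after
`j`. A stage has `(3j)^j` phases, one for each choice of a class in every transversal coordinate
`l < j` (the digits of `e` in base `3j`); in a phase, `A` runs simultaneously on all the lines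
whose transversal coordinates are in the chosen classes. Stage `0` is one execution of `A` on the
line of the source, and stage `1` has three phases, on the lines at
`h, 7h, 13h, …`, at `3h, 9h, 15h, …` and at `5h, 11h, 17h, …`. -/
def algAd (d L r s : ℕ) (src : LatticeNode d L) : List (Set (LatticeNode d L)) :=
  (List.finRange d).flatMap fun j : Fin d =>
    (List.range ((3 * (j : ℕ)) ^ (j : ℕ))).flatMap fun e =>
      (algA L r s (src j)).map fun S =>
        {v | ((v j : ℕ) : ℤ) ∈ S ∧
          (∀ l : Fin d, l < j →
            ((v l : ℕ) ∈ lineCoords L r j (e / (3 * (j : ℕ)) ^ (l : ℕ) % (3 * (j : ℕ))))) ∧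
          ∀ l : Fin d, j < l → v l = src l}

/-! Correctness rests on one principle: if the scheduled nodes of a round are pairwise more than
`2r` apart, no node has two of them within `r`, so every informed sender serves its whole annulus of
radii `s` and `r`. Put `w = r - (s + 1)`. In `Local*` the second sender of a step is at distance
exactly `r` from the first, and the first sender of the next step is at distance `r - w = s + 1`
from that second sender, so each transmission informs the next sender (`served_localScheme`).

On a parallel line at squared offset `D ≤ 3r²/4`, an annulus still cuts out an interval `[σ, R]` of
distances with `R` about `r/2` or more. Either `σ = 0`, or the interval has length at least `w`, the
spacing of the senders (`exists_reception_interval`). Hence `2r` consecutive labels are covered,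
shifted by a margin `μ` of about `r/2` at most (`exists_sender_of_block`). Blocks of length `2r`
tile the line, and the two terminations repair its ends (`mem_bcast_algA`).

For `A^d`, lines of one phase are more than `2r` apart, and `j` coordinates each off by at most
`halfGap r j` give `D ≤ 3r²/4`. Stage `j` therefore frees coordinate `j`: the nodes agreeing with
the source after `j` become informed (`mem_bcast_stage`).

The upper bound counts rounds. For the lower bound, the message moves at most `r` per round along an
axis, giving order `L/r`. The node at label `c % r + s` on the source line is swamped by, or out of
range of, every sender of the sparse part and of the early steps of `Local*`, giving order `r/w`
(`le_add_one_mul_of_forall_mem_informed`). -/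

/-! ### Integer intervals covered by the transmissions of `Local*` -/

/-- The transmissions of `Local*` reach the label `y` if a transmission from any distance between
`σ` and `R` is received. Labels are relative to the starting label, and `M` is the last label of
the line. -/
theorem exists_sender_of_block {r w x σ R M y : ℕ} (hw : 1 ≤ w) (hwr : w + 2 ≤ r)
    (hx : r ≤ x * w) (hx' : x * w < r + w) (hR : r ≤ 2 * R + 1)
    (hσ : σ = 0 ∨ (σ + w ≤ R ∧ σ + w ≤ r)) (hM : 2 * r ≤ M + 1) (hyM : y ≤ M)
    (hy : min σ (r - R) ≤ y) (hy' : y + 1 ≤ 2 * r + min σ (r - R)) :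
    ∃ i ≤ x, ∃ p : ℕ, (p = i * w ∨ p = i * w + r) ∧ p ≤ M ∧
      σ ≤ ((y : ℤ) - p).natAbs ∧ ((y : ℤ) - p).natAbs ≤ R := by
  have hdiv : ∀ z : ℕ, z / w * w ≤ z ∧ z < z / w * w + w := fun z =>
    ⟨Nat.div_mul_le_self z w, Nat.lt_div_mul_add (by omega)⟩
  have hlt : ∀ i : ℕ, i * w < x * w → i + 1 ≤ x := fun i h => lt_of_mul_lt_mul_right' h
  rcases hσ with rfl | ⟨hσR, hσr⟩
  · rw [Nat.zero_min] at hy hy'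
    -- With `σ = 0` only the outer radius matters: two consecutive senders, shifted by `r` if `y ≥
    -- r`, bracket `y`, and their gap `w < 2R` puts one of them within `R`.
    rcases lt_or_ge y r with hyr | hyr
    · obtain ⟨h1, h2⟩ := hdiv y
      have hi := hlt (y / w) (by omega)
      have hs : (y / w + 1) * w = y / w * w + w := by ring
      by_cases hc : y ≤ y / w * w + R
      · exact ⟨y / w, by omega, _, Or.inl rfl, by omega, by omega, by omega⟩
      · exact ⟨y / w + 1, hi, _, Or.inl rfl, by omega, by omega, by omega⟩
    · obtain ⟨h1, h2⟩ := hdiv (y - r)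
      set i := (y - r) / w with hidef
      have hi := hlt i (by omega)
      have hs : (i + 1) * w = i * w + w := by ring
      by_cases hc : y - r ≤ i * w + R
      · exact ⟨i, by omega, _, Or.inr rfl, by omega, by omega, by omega⟩
      · by_cases hc' : (i + 1) * w + r ≤ M
        · exact ⟨i + 1, hi, _, Or.inr rfl, by omega, by omega, by omega⟩
        -- If the right-hand sender is off the line, then `i ≥ 1` and `(i + 1) * w ≥ r`, so `2 * i *
        -- w ≥ r` and `i * w + R ≥ r`, against `i * w + R < y - r ≤ r - 1`.
        · exfalso
          rcases Nat.eq_zero_or_pos i with h0 | h0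
          · rw [h0] at hs hc' h1 h2 hc
            omega
          · have : 1 * w ≤ i * w := Nat.mul_le_mul_right w h0
            omega
  -- The distances `σ, …, σ + w - 1` are all admissible, so senders at spacing `w` cannot skip them.
  -- Labels `y ≥ σ` use a sender on their left, the others one on their right.
  · by_cases hyσ : y < σ
    · by_cases h0 : y + σ ≤ r
      · exact ⟨0, Nat.zero_le _, r, Or.inr (by simp), by omega, by omega, by omega⟩
      · obtain ⟨h1, h2⟩ := hdiv (y + σ - r + (w - 1))
        set i := (y + σ - r + (w - 1)) / w
        have hi := hlt i (by omega)
        exact ⟨i, by omega, _, Or.inr rfl, by omega, by omega, by omega⟩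
    · by_cases hyr : y < r + σ
      · obtain ⟨h1, h2⟩ := hdiv (y - σ)
        have hi := hlt ((y - σ) / w) (by omega)
        exact ⟨(y - σ) / w, by omega, _, Or.inl rfl, by omega, by omega, by omega⟩
      · obtain ⟨h1, h2⟩ := hdiv (y - σ - r)
        rcases lt_or_ge x ((y - σ - r) / w) with hi | hi
        -- This case is contradictory, since `r ≤ x * w` and `y < 2r + σ`; the witness is
        -- immaterial.
        · have := Nat.mul_le_mul_right w hi.le
          exact ⟨x, le_rfl, _, Or.inr rfl, by omega, by omega, by omega⟩
        · exact ⟨_, hi, _, Or.inr rfl, by omega, by omega, by omega⟩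

/-- The distances `δ` along a line at which a transmission from the line is received at squared
distance `D` from the line include an interval `[σ, R]`. -/
theorem exists_reception_interval {r s w D : ℕ} (hw : r = s + 1 + w)
    (hD : 4 * D ≤ 3 * r ^ 2) :
    ∃ σ R : ℕ, r ≤ 2 * R + 1 ∧ (σ = 0 ∨ (σ + w ≤ R ∧ σ + w ≤ r)) ∧
      (D = 0 → min σ (r - R) = 0) ∧
      ∀ δ : ℕ, σ ≤ δ → δ ≤ R → s ^ 2 < δ ^ 2 + D ∧ δ ^ 2 + D ≤ r ^ 2 := by
  have hDr : D ≤ r ^ 2 := by omega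
  have hR1 := Nat.sqrt_le' (r ^ 2 - D)
  have hR2 := Nat.lt_succ_sqrt' (r ^ 2 - D)
  set R := Nat.sqrt (r ^ 2 - D) with hRdef
  -- The bound on `D` leaves `r² - D ≥ r² / 4`; this is where the factor `√3 / 2` is used.
  have hR : r ≤ 2 * R + 1 := by
    by_contra! h
    have h3 : (2 * (R + 1)) ^ 2 ≤ r ^ 2 := Nat.pow_le_pow_left (by omega) 2
    have : (2 * (R + 1)) ^ 2 = 4 * (R + 1) ^ 2 := by ring
    simp only [Nat.succ_eq_add_one] at hR2
    omega
  have hRδ : ∀ δ : ℕ, δ ≤ R → δ ^ 2 + D ≤ r ^ 2 := fun δ h => by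
    have := Nat.pow_le_pow_left h 2
    omega
  rcases lt_or_ge (s ^ 2) D with hs | hs
  · exact ⟨0, R, hR, Or.inl rfl, fun _ => Nat.zero_min _, fun δ _ h => ⟨by omega, hRδ δ h⟩⟩
  · have hS1 := Nat.sqrt_le' (s ^ 2 - D)
    have hS2 := Nat.lt_succ_sqrt' (s ^ 2 - D)
    set S := Nat.sqrt (s ^ 2 - D) with hSdef
    have hSs : S ≤ s := by
      by_contra! h
      have := Nat.pow_lt_pow_left h two_ne_zero
      omega
    refine ⟨S + 1, R, hR, Or.inr ⟨?_, by omega⟩, ?_, fun δ h h' => ⟨?_, hRδ δ h'⟩⟩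
    -- The annulus does not get thinner off the line: with `r = s + (w + 1)`, both squares expand
    -- alike, and `S ≤ s`, `S² ≤ s² - D`.
    · rw [hRdef, Nat.le_sqrt']
      have e1 : (S + 1 + w) ^ 2 = S ^ 2 + 2 * (S * (w + 1)) + (w + 1) ^ 2 := by ring
      have e2 : r ^ 2 = s ^ 2 + 2 * (s * (w + 1)) + (w + 1) ^ 2 := by rw [hw]; ring
      have e3 : S * (w + 1) ≤ s * (w + 1) := Nat.mul_le_mul_right _ hSs
      omega
    · rintro rfl
      have : R = r := by rw [hRdef, Nat.sub_zero, Nat.sqrt_eq']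
      omega
    · have := Nat.pow_le_pow_left h 2
      simp only [Nat.succ_eq_add_one] at hS2
      omega

/-! ### Squared distances -/

/-- The squared Euclidean distance of two nodes. -/
def sqDist {d L : ℕ} (u v : LatticeNode d L) : ℤ := ∑ l, ((u l : ℤ) - (v l : ℤ)) ^ 2

section Distance

variable {d L : ℕ}

theorem dist_pos_eq_sqrt (u v : LatticeNode d L) :
    dist u.pos v.pos = Real.sqrt (sqDist u v : ℤ) := by
  rw [EuclideanSpace.dist_eq]
  simp [sqDist, LatticeNode.pos, Real.dist_eq, sq_abs]

theorem dist_pos_le_iff (u v : LatticeNode d L) (r : ℕ) :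
    dist u.pos v.pos ≤ (r : ℝ) ↔ sqDist u v ≤ (r : ℤ) ^ 2 := by
  rw [dist_pos_eq_sqrt, Real.sqrt_le_left (Nat.cast_nonneg r)]
  exact_mod_cast Iff.rfl

theorem lt_dist_pos_iff (u v : LatticeNode d L) (s : ℕ) :
    (s : ℝ) < dist u.pos v.pos ↔ (s : ℤ) ^ 2 < sqDist u v := by
  rw [← not_le, dist_pos_le_iff, not_le]

theorem sq_sub_le_sqDist (u v : LatticeNode d L) (l : Fin d) :
    ((u l : ℤ) - (v l : ℤ)) ^ 2 ≤ sqDist u v :=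
  Finset.single_le_sum (f := fun l => ((u l : ℤ) - (v l : ℤ)) ^ 2)
    (fun _ _ => sq_nonneg _) (Finset.mem_univ l)

theorem abs_sub_le_of_dist_pos_le {u v : LatticeNode d L} {r : ℕ}
    (h : dist u.pos v.pos ≤ (r : ℝ)) (l : Fin d) : |(u l : ℤ) - (v l : ℤ)| ≤ r :=
  abs_le_of_sq_le_sq ((sq_sub_le_sqDist u v l).trans ((dist_pos_le_iff u v r).1 h))
    (Nat.cast_nonneg r)

theorem two_mul_lt_dist_pos {u v : LatticeNode d L} {r : ℕ} {l : Fin d}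
    (h : 2 * (r : ℤ) < |(u l : ℤ) - (v l : ℤ)|) : 2 * (r : ℝ) < dist u.pos v.pos := by
  by_contra! hle
  have := abs_sub_le_of_dist_pos_le (r := 2 * r) (by exact_mod_cast hle) l
  push_cast at this
  omega

theorem sqDist_eq_of_forall_ne {u v : LatticeNode d L} {j : Fin d}
    (h : ∀ l, l ≠ j → u l = v l) : sqDist u v = ((u j : ℤ) - (v j : ℤ)) ^ 2 := by
  refine Finset.sum_eq_single j (fun l _ hl => ?_) (by simp)
  rw [h l hl]
  simp

theorem sqDist_eq_add {u b : LatticeNode d L} {j : Fin d} (h : ∀ l, l ≠ j → u l = b l)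
    (v : LatticeNode d L) :
    sqDist u v = ((u j : ℤ) - (v j : ℤ)) ^ 2 +
      ∑ l ∈ Finset.univ.erase j, ((b l : ℤ) - (v l : ℤ)) ^ 2 := by
  rw [sqDist, ← Finset.add_sum_erase _ _ (Finset.mem_univ j)]
  congr 1
  refine Finset.sum_congr rfl fun l hl => ?_
  rw [h l (Finset.ne_of_mem_erase hl)]

end Distance

/-! ### Running a schedule from an arbitrary set of informed nodes -/

section Run

variable {d L : ℕ} {r s : ℕ}

/-- The nodes that are informed after the rounds of a schedule, if those of `I` are informed
before. -/
def bcast (r s : ℕ) (sched : List (Set (LatticeNode d L))) (I : Set (LatticeNode d L)) :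
    Set (LatticeNode d L) :=
  sched.foldl (fun I X => I ∪ {v | Receives r s (X ∩ I) v}) I

theorem bcast_append (l l' : List (Set (LatticeNode d L))) (I : Set (LatticeNode d L)) :
    bcast r s (l ++ l') I = bcast r s l' (bcast r s l I) :=
  List.foldl_append

theorem subset_bcast (l : List (Set (LatticeNode d L))) (I : Set (LatticeNode d L)) :
    I ⊆ bcast r s l I := by
  induction l generalizing I with
  | nil => exact subset_rfl
  | cons X l ih => exact Set.subset_union_left.trans (ih _)

theorem informed_eq_bcast (sched : List (Set (LatticeNode d L))) (src : LatticeNode d L)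
    {t : ℕ} (ht : t ≤ sched.length) :
    informed r s sched src t = bcast r s (sched.take t) {src} := by
  induction t with
  | zero => rfl
  | succ t ih =>
    have hlt : t < sched.length := ht
    rw [← List.take_concat_get' _ _ hlt, bcast_append, ← ih hlt.le]
    simp only [informed, bcast, List.foldl_cons, List.foldl_nil]
    rw [List.getD_eq_getElem _ _ hlt]

theorem informed_length (sched : List (Set (LatticeNode d L))) (src : LatticeNode d L) :
    informed r s sched src sched.length = bcast r s sched {src} := by
  rw [informed_eq_bcast _ _ le_rfl, List.take_length]

/-- A transmission is received at every node between the distances `s` and `r` if the scheduled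
nodes are pairwise further apart than `2r`. -/
theorem mem_bcast_of_pairwise {X I : Set (LatticeNode d L)} {u v : LatticeNode d L}
    (hX : X.Pairwise fun u u' => 2 * (r : ℝ) < dist u.pos u'.pos) (huX : u ∈ X) (huI : u ∈ I)
    (hs : (s : ℝ) < dist u.pos v.pos) (hr : dist u.pos v.pos ≤ (r : ℝ)) :
    v ∈ bcast r s [X] I := by
  have key : ∀ u' ∈ X, dist u'.pos v.pos ≤ (r : ℝ) → u' = u := fun u' hu' h => by
    by_contra hne
    have h1 := hX hu' huX hne
    have h2 := dist_triangle_right u'.pos u.pos v.pos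
    linarith
  have hsr : (s : ℝ) ≤ r := hs.le.trans hr
  refine Or.inr ⟨fun hv => ?_, ⟨u, ⟨⟨huX, huI⟩, hs, hr⟩, fun u' h => key u' h.1.1 h.2.2⟩,
    fun u' hu' h => ?_⟩
  · have := key v hv.1 (by rw [dist_self]; positivity)
    rw [this, dist_self] at hs
    exact absurd hs (not_lt.2 (Nat.cast_nonneg s))
  · rw [key u' hu'.1 (h.trans hsr)] at h
    linarith

/-- A node does not get the message while no node scheduled is its neighbour. -/
theorem notMem_bcast_of_not_adj {l : List (Set (LatticeNode d L))} {I : Set (LatticeNode d L)}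
    {v : LatticeNode d L} (hv : v ∉ I)
    (h : ∀ X ∈ l, ∀ u ∈ X, ¬ (swampGraph d L r s).Adj u v) : v ∉ bcast r s l I := by
  induction l generalizing I with
  | nil => exact hv
  | cons X l ih =>
    refine ih (fun hv' => ?_) fun Y hY => h Y (List.mem_cons_of_mem _ hY)
    rcases hv' with hv' | ⟨_, ⟨u, ⟨hu, ha⟩, _⟩, _⟩
    · exact hv hv'
    · exact h X List.mem_cons_self u hu.1 ha

/-- The message travels at most `r` per round along each axis. -/
theorem abs_sub_le_of_mem_informed {sched : List (Set (LatticeNode d L))}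
    {src v : LatticeNode d L} {t : ℕ} (hv : v ∈ informed r s sched src t) (l : Fin d) :
    |(v l : ℤ) - (src l : ℤ)| ≤ t * r := by
  induction t generalizing v with
  | zero =>
    have : v = src := hv
    simp [this]
  | succ t ih =>
    rcases hv with hv | ⟨_, ⟨u, ⟨hu, ha⟩, _⟩, _⟩
    · refine (ih hv).trans ?_
      push_cast
      nlinarith
    · have h1 := abs_sub_le_of_dist_pos_le ha.2 l
      have h2 := ih hu.2
      rw [abs_le] at *
      push_cast
      constructor <;> nlinarith

end Run

/-! ### Simultaneous execution on lines -/

section Lines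

variable {d L : ℕ} {r s : ℕ}

/-- The nodes of the lines given by `T` whose label along axis `j` is in `S`. -/
def onLines (j : Fin d) (T : LatticeNode d L → Prop) (S : Set ℤ) : Set (LatticeNode d L) :=
  {v | ((v j : ℕ) : ℤ) ∈ S ∧ T v}

/-- The predicate `T` describes a family of lines parallel to axis `j`, and points of different
lines are further apart than `2r`. -/
structure IsLineFamily (r : ℕ) (j : Fin d) (T : LatticeNode d L → Prop) : Prop where
  mem_of_agree : ∀ u b, (∀ l, l ≠ j → u l = b l) → T b → T u
  agree_or_far : ∀ u u', T u → T u' →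
    (∀ l, l ≠ j → u l = u' l) ∨ 2 * (r : ℝ) < dist u.pos u'.pos

/-- The node with label `a` on the line through `b` parallel to axis `j`, if there is one, is in
`I`. -/
def Known (j : Fin d) (b : LatticeNode d L) (I : Set (LatticeNode d L)) (a : ℤ) : Prop :=
  ∀ u : LatticeNode d L, (∀ l, l ≠ j → u l = b l) → (u j : ℤ) = a → u ∈ I

/-- All neighbours of the node with label `a` on the line through `b` parallel to axis `j`, if
there is one, are in `I`. -/
def Served (r s : ℕ) (j : Fin d) (b : LatticeNode d L) (I : Set (LatticeNode d L)) (a : ℤ) :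
    Prop :=
  ∀ u v : LatticeNode d L, (∀ l, l ≠ j → u l = b l) → (u j : ℤ) = a →
    (swampGraph d L r s).Adj u v → v ∈ I

theorem Known.mono {j : Fin d} {b : LatticeNode d L} {I I' : Set (LatticeNode d L)} {a : ℤ}
    (h : Known j b I a) (hI : I ⊆ I') : Known j b I' a :=
  fun u hu ha => hI (h u hu ha)

theorem Served.mono {j : Fin d} {b : LatticeNode d L} {I I' : Set (LatticeNode d L)} {a : ℤ}
    (h : Served r s j b I a) (hI : I ⊆ I') : Served r s j b I' a :=
  fun u v hu ha hv => hI (h u v hu ha hv)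

theorem exists_node_on_line (j : Fin d) (b : LatticeNode d L) {a : ℤ} (h0 : 0 ≤ a)
    (hL : a < L) : ∃ u : LatticeNode d L, (∀ l, l ≠ j → u l = b l) ∧ (u j : ℤ) = a := by
  lift a to ℕ using h0
  refine ⟨Function.update b j ⟨a, by omega⟩, fun l hl => Function.update_of_ne hl _ _, ?_⟩
  simp

theorem Served.mem {j : Fin d} {b v : LatticeNode d L} {I : Set (LatticeNode d L)} {a : ℤ}
    (h : Served r s j b I a) (h0 : 0 ≤ a) (hL : a < L)
    (hs : (s : ℤ) ^ 2 < (a - (v j : ℤ)) ^ 2 +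
      ∑ l ∈ Finset.univ.erase j, ((b l : ℤ) - (v l : ℤ)) ^ 2)
    (hr : (a - (v j : ℤ)) ^ 2 + ∑ l ∈ Finset.univ.erase j, ((b l : ℤ) - (v l : ℤ)) ^ 2
      ≤ (r : ℤ) ^ 2) : v ∈ I := by
  obtain ⟨u, hu, rfl⟩ := exists_node_on_line j b h0 hL
  refine h u v hu rfl ⟨?_, ?_⟩
  · rw [lt_dist_pos_iff, sqDist_eq_add hu]
    exact hs
  · rw [dist_pos_le_iff, sqDist_eq_add hu]
    exact hr

theorem Served.known {j : Fin d} {b : LatticeNode d L} {I : Set (LatticeNode d L)} {a y : ℤ}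
    (h : Served r s j b I a) (h0 : 0 ≤ a) (hL : a < L) (hs : s < (a - y).natAbs)
    (hr : (a - y).natAbs ≤ r) : Known j b I y := by
  rintro v hv rfl
  have hsum : ∑ l ∈ Finset.univ.erase j, ((b l : ℤ) - (v l : ℤ)) ^ 2 = 0 :=
    Finset.sum_eq_zero fun l hl => by rw [hv l (Finset.ne_of_mem_erase hl)]; simp
  have hsq : (a - (v j : ℤ)) ^ 2 = (((a - (v j : ℤ)).natAbs : ℕ) : ℤ) ^ 2 := by simp
  refine h.mem h0 hL ?_ ?_
  · rw [hsum, add_zero, hsq]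
    exact_mod_cast Nat.pow_lt_pow_left hs two_ne_zero
  · rw [hsum, add_zero, hsq]
    exact_mod_cast Nat.pow_le_pow_left hr 2

/-- Two senders on one line are separated by their labels, two on different lines by the family. -/
theorem pairwise_onLines {j : Fin d} {T : LatticeNode d L → Prop} (hT : IsLineFamily r j T)
    {S : Set ℤ} (hS : S.Pairwise fun a a' => 2 * (r : ℤ) < |a - a'|) :
    (onLines j T S).Pairwise fun u u' => 2 * (r : ℝ) < dist u.pos u'.pos := by
  intro u hu u' hu' hne
  rcases hT.agree_or_far u u' hu.2 hu'.2 with h | h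
  · refine two_mul_lt_dist_pos (l := j) (hS hu.1 hu'.1 fun he => hne ?_)
    funext l
    by_cases hl : l = j
    · subst hl
      exact Fin.ext (by exact_mod_cast he)
    · exact h l hl
  · exact h

/-- One round of an algorithm on the lines of a family. -/
theorem Known.served_bcast {j : Fin d} {T : LatticeNode d L → Prop} (hT : IsLineFamily r j T)
    {b : LatticeNode d L} (hb : T b) {S : Set ℤ}
    (hS : S.Pairwise fun a a' => 2 * (r : ℤ) < |a - a'|) {I : Set (LatticeNode d L)} {a : ℤ}
    (haS : a ∈ S) (ha : Known j b I a) : Served r s j b (bcast r s [onLines j T S] I) a := by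
  rintro u v hu rfl hv
  exact mem_bcast_of_pairwise (pairwise_onLines hT hS) ⟨haS, hT.mem_of_agree u b hu hb⟩
    (ha u hu rfl) hv.1 hv.2

end Lines

/-! ### Algorithm `A` on a family of lines -/

section LineAlgorithm

variable {d L : ℕ} {r s : ℕ}

theorem pairwise_translate {K : Set ℤ} (hK : K.Pairwise fun a a' => 2 * (r : ℤ) < |a - a'|)
    (z : ℤ) : {y | ∃ k ∈ K, y = k + z}.Pairwise fun a a' => 2 * (r : ℤ) < |a - a'| := by
  rintro _ ⟨k, hk, rfl⟩ _ ⟨k', hk', rfl⟩ hne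
  have := hK hk hk' fun h => hne (by rw [h])
  rwa [add_sub_add_right_eq_sub]

theorem le_ceilDiv_mul {r w : ℕ} (hw : 0 < w) : r ≤ r ⌈/⌉ w * w := by
  have := (ceilDiv_le_iff_le_mul hw).1 (le_refl (r ⌈/⌉ w))
  rwa [mul_comm] at this

theorem ceilDiv_mul_lt {r w : ℕ} (hw : 0 < w) (hr : 0 < r) : r ⌈/⌉ w * w < r + w := by
  rw [Nat.ceilDiv_eq_add_pred_div]
  have := Nat.div_mul_le_self (r + w - 1) w
  omega

/-- `Local*` proceeds from `k` as long as the labels at which it has to transmit are on the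
line. -/
theorem served_localScheme {j : Fin d} {T : LatticeNode d L → Prop} (hT : IsLineFamily r j T)
    {b : LatticeNode d L} (hb : T b) (hsr : s + 1 < r) {ε : ℤ} (hε : ε = 1 ∨ ε = -1) {K : Set ℤ}
    (hK : K.Pairwise fun a a' => 2 * (r : ℤ) < |a - a'|) {k : ℤ} (hk : k ∈ K) (h0 : 0 ≤ k)
    (hL : k < L) {I : Set (LatticeNode d L)} (hI : Known j b I k) {i : ℕ}
    (hi : i ≤ r ⌈/⌉ (r - (s + 1)))
    (hline : ∀ m < i, 0 ≤ k + ε * ((m * (r - (s + 1)) + r : ℕ) : ℤ) ∧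
      k + ε * ((m * (r - (s + 1)) + r : ℕ) : ℤ) < L) :
    Served r s j b (bcast r s ((localScheme r s ε K).map (onLines j T)) I)
        (k + ε * ((i * (r - (s + 1)) : ℕ) : ℤ)) ∧
      Served r s j b (bcast r s ((localScheme r s ε K).map (onLines j T)) I)
        (k + ε * ((i * (r - (s + 1)) + r : ℕ) : ℤ)) := by
  rw [localScheme]
  have hi' := Nat.lt_succ_of_le hi
  rw [Nat.succ_eq_add_one] at hi'
  clear hi
  generalize r ⌈/⌉ (r - (s + 1)) + 1 = n at *
  induction n generalizing i with
  | zero => omega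
  | succ n ih =>
    rw [List.range_succ, List.flatMap_append, List.map_append, bcast_append]
    rcases Nat.lt_succ_iff_lt_or_eq.1 hi' with h | rfl
    · obtain ⟨h1, h2⟩ := ih hline h
      exact ⟨h1.mono (subset_bcast _ _), h2.mono (subset_bcast _ _)⟩
    -- The first sender of a step is at distance `s + 1` from the second sender of the previous
    -- step, the smallest distance at which a transmission is received.
    · have hprev : Known j b (bcast r s (List.map (onLines j T) ((List.range i).flatMap fun i =>
          [{y | ∃ k ∈ K, y = k + ε * ((i * (r - (s + 1)) : ℕ) : ℤ)},
            {y | ∃ k ∈ K, y = k + ε * ((i * (r - (s + 1)) + r : ℕ) : ℤ)}])) I)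
          (k + ε * ((i * (r - (s + 1)) : ℕ) : ℤ)) ∧
          0 ≤ k + ε * ((i * (r - (s + 1)) : ℕ) : ℤ) ∧
          k + ε * ((i * (r - (s + 1)) : ℕ) : ℤ) < L := by
        rcases i with - | m
        · simpa using ⟨hI.mono (subset_bcast _ _), h0, hL⟩
        · obtain ⟨h1, h2⟩ := hline m (by omega)
          have h3 := (ih (i := m) (fun m' hm' => hline m' (by omega)) (by omega)).2
          have e : (m + 1) * (r - (s + 1)) = m * (r - (s + 1)) + (r - (s + 1)) := by ring
          rw [e]
          generalize m * (r - (s + 1)) = z at *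
          rcases hε with rfl | rfl
          · exact ⟨h3.known h1 h2 (by omega) (by omega), by omega, by omega⟩
          · exact ⟨h3.known h1 h2 (by omega) (by omega), by omega, by omega⟩
      obtain ⟨hkn, h1, h2⟩ := hprev
      generalize bcast r s (List.map (onLines j T) ((List.range i).flatMap fun i =>
          [{y | ∃ k ∈ K, y = k + ε * ((i * (r - (s + 1)) : ℕ) : ℤ)},
            {y | ∃ k ∈ K, y = k + ε * ((i * (r - (s + 1)) + r : ℕ) : ℤ)}])) I = J at *
      rw [List.flatMap_singleton, List.map_cons, ← List.singleton_append, bcast_append]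
      have h3 := hkn.served_bcast (s := s) hT hb
        (pairwise_translate hK (ε * ((i * (r - (s + 1)) : ℕ) : ℤ))) ⟨k, hk, rfl⟩
      refine ⟨h3.mono (subset_bcast _ _), Known.served_bcast hT hb
        (pairwise_translate hK (ε * ((i * (r - (s + 1)) + r : ℕ) : ℤ))) ⟨k, hk, rfl⟩
        (h3.known h1 h2 ?_ ?_)⟩
      · rcases hε with rfl | rfl <;> omega
      · rcases hε with rfl | rfl <;> omega

/-- An execution of `Local*` on `2r` labels of the line informs all nodes within distance
`√3 r / 2` of the line and next to these labels, up to a margin `μ` that is `0` on the line. -/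
theorem mem_bcast_localScheme {j : Fin d} {T : LatticeNode d L → Prop} (hT : IsLineFamily r j T)
    {b : LatticeNode d L} (hb : T b) (hs : 1 ≤ s) (hsr : s + 1 < r) {D : ℕ}
    (hD : 4 * D ≤ 3 * r ^ 2) :
    ∃ μ : ℕ, 2 * μ ≤ r + 1 ∧ (D = 0 → μ = 0) ∧
      ∀ (ε : ℤ) (K : Set ℤ) (k : ℤ) (I : Set (LatticeNode d L)) (M y : ℕ) (v : LatticeNode d L),
        ε = 1 ∨ ε = -1 → (K.Pairwise fun a a' => 2 * (r : ℤ) < |a - a'|) → k ∈ K → 0 ≤ k →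
        k < L → Known j b I k → 2 * r ≤ M + 1 → 0 ≤ k + ε * M → k + ε * M < L →
        μ ≤ y → y + 1 ≤ 2 * r + μ → y ≤ M → (v j : ℤ) = k + ε * y →
        ∑ l ∈ Finset.univ.erase j, ((b l : ℤ) - (v l : ℤ)) ^ 2 = D →
        v ∈ bcast r s ((localScheme r s ε K).map (onLines j T)) I := by
  obtain ⟨w, hw⟩ : ∃ w, r = s + 1 + w := ⟨r - (s + 1), by omega⟩
  have hw' : r - (s + 1) = w := by omega
  obtain ⟨σ, R, hR, hσ, h0, hδ⟩ := exists_reception_interval hw hD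
  -- The bound on the margin comes from `r - R` and `r ≤ 2R + 1`.
  refine ⟨min σ (r - R), by omega, h0, ?_⟩
  intro ε K k I M y v hε hK hk hk0 hkL hI hM hM0 hML hy hy' hyM hv hDv
  have hx := le_ceilDiv_mul (r := r) (w := w) (by omega)
  have hx' := ceilDiv_mul_lt (r := r) (w := w) (by omega) (by omega)
  obtain ⟨i, hi, p, hp, hpM, hp1, hp2⟩ :=
    exists_sender_of_block (by omega) (by omega) hx hx' hR hσ hM hyM hy hy'
  have hserved := served_localScheme hT hb hsr hε hK hk hk0 hkL hI (i := i)
    (by rwa [hw']) (fun m hm => by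
      rw [hw']
      -- For `m < i` this gives `m * w < r`, so the second senders before step `i` are among the
      -- first `2r` labels. The one of step `i` may fall off the line.
      have h1 : (m + 1) * w ≤ r ⌈/⌉ w * w := Nat.mul_le_mul_right w (by omega)
      rw [add_mul, one_mul] at h1
      rcases hε with rfl | rfl <;> constructor <;> omega)
  rw [hw'] at hserved
  have hsp : Served r s j b (bcast r s ((localScheme r s ε K).map (onLines j T)) I)
      (k + ε * (p : ℤ)) := by
    rcases hp with rfl | rfl
    · exact hserved.1
    · exact hserved.2
  have hsq : (k + ε * (p : ℤ) - (v j : ℤ)) ^ 2 = ((((y : ℤ) - p).natAbs : ℕ) : ℤ) ^ 2 := by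
    rw [hv, Int.natAbs_sq]
    rcases hε with rfl | rfl <;> ring
  obtain ⟨h1, h2⟩ := hδ _ hp1 hp2
  refine hsp.mem ?_ ?_ ?_ ?_
  · rcases hε with rfl | rfl <;> omega
  · rcases hε with rfl | rfl <;> omega
  · rw [hDv, hsq]
    exact_mod_cast h1
  · rw [hDv, hsq]
    exact_mod_cast h2

/-- Transmissions one after another along a sequence of labels with step `r`. -/
theorem known_and_served_chain {j : Fin d} {T : LatticeNode d L → Prop}
    (hT : IsLineFamily r j T) {b : LatticeNode d L} (hb : T b) (hsr : s < r) {a : ℕ → ℤ} {N : ℕ}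
    (ha : ∀ m < N, 0 ≤ a m ∧ a m < L) (hstep : ∀ m, (a m - a (m + 1)).natAbs = r)
    {I : Set (LatticeNode d L)} (hI : Known j b I (a 0)) {m : ℕ} (hm : m ≤ N) :
    Known j b (bcast r s (((List.range N).map fun m => ({a m} : Set ℤ)).map (onLines j T)) I)
        (a m) ∧
      (m < N → Served r s j b
        (bcast r s (((List.range N).map fun m => ({a m} : Set ℤ)).map (onLines j T)) I) (a m)) := by
  induction N generalizing m with
  | zero =>
    obtain rfl : m = 0 := by omega
    exact ⟨hI.mono (subset_bcast _ _), fun h => absurd h (lt_irrefl 0)⟩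
  | succ n ih =>
    have ih := fun {m} => ih (m := m) fun m' hm' => ha m' (by omega)
    rw [List.range_succ, List.map_append, List.map_append, bcast_append]
    have hn := (ih le_rfl).1.served_bcast (s := s) hT hb (S := {a n})
      (Set.pairwise_singleton _ _) rfl
    rcases Nat.le_add_one_iff.1 hm with h | rfl
    · refine ⟨(ih h).1.mono (subset_bcast _ _), fun _ => ?_⟩
      rcases h.lt_or_eq with h' | rfl
      · exact ((ih h).2 h').mono (subset_bcast _ _)
      · exact hn
    · obtain ⟨h1, h2⟩ := ha n (by omega)
      have := hstep n
      exact ⟨hn.known h1 h2 (by omega) (by omega), fun h => absurd h (lt_irrefl _)⟩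

/-- The sparse transmission informs all nodes of the line whose label is congruent to that of the
source modulo `r`. -/
theorem known_sparsePart {j : Fin d} {T : LatticeNode d L → Prop} (hT : IsLineFamily r j T)
    {b : LatticeNode d L} (hb : T b) (hsr : s < r) {c : ℕ} (hc : c < L)
    {I : Set (LatticeNode d L)} (hI : Known j b I c) {a : ℕ} (haL : a < L)
    (ha : a % r = c % r) :
    Known j b (bcast r s ((sparsePart L r c).map (onLines j T)) I) a := by
  rw [sparsePart, List.map_append, bcast_append]
  have hup := fun {m : ℕ} => known_and_served_chain hT hb hsr (s := s)
    (a := fun m => ((c + m * r : ℕ) : ℤ)) (N := (L - 1 - c) / r + 1) (m := m) (I := I)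
    (fun m hm => by
      have h1 := Nat.mul_le_mul_right r (show m ≤ (L - 1 - c) / r by omega)
      have h2 := Nat.div_mul_le_self (L - 1 - c) r
      constructor <;> omega)
    (fun m => by
      have : (m + 1) * r = m * r + r := by ring
      simp only [this]
      omega) (by simpa using hI)
  have hr : 0 < r := by omega
  rcases le_total c a with hca | hca
  · obtain ⟨m, hm⟩ := (Nat.modEq_iff_dvd' hca).1 ha.symm
    have hm' : a = c + m * r := by rw [mul_comm]; omega
    have : m ≤ (L - 1 - c) / r := by
      rw [Nat.le_div_iff_mul_le hr]
      omega
    rw [hm']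
    exact (hup (by omega)).1.mono (subset_bcast _ _)
  · obtain ⟨m, hm⟩ := (Nat.modEq_iff_dvd' hca).1 ha
    rcases m with - | m
    · obtain rfl : a = c := by omega
      exact (hI.mono (subset_bcast _ _)).mono (subset_bcast _ _)
    have hm' : (a : ℤ) = (c : ℤ) - (((m + 1) * r : ℕ) : ℤ) := by
      rw [mul_comm]
      omega
    -- The downward chain starts from the source's own transmission, the first round of the upward
    -- chain.
    have hserved := (hup (m := 0) (Nat.zero_le _)).2 (Nat.succ_pos _)
    have hN : m + 1 ≤ c / r := by
      rw [Nat.le_div_iff_mul_le hr]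
      omega
    rw [hm']
    refine (known_and_served_chain hT hb hsr
      (a := fun m => (c : ℤ) - (((m + 1) * r : ℕ) : ℤ)) (N := c / r) (m := m)
      (fun m hm => ?_) (fun m => ?_) (hserved.known ?_ ?_ ?_ ?_) (by omega)).1
    · have h1 := Nat.mul_le_mul_right r (show m + 1 ≤ c / r by omega)
      have h2 := Nat.div_mul_le_self c r
      constructor <;> omega
    · have : (m + 1 + 1) * r = (m + 1) * r + r := by ring
      simp only [this]
      omega
    all_goals simp
    all_goals omega

/-- The starting labels of a parallel execution of `Local*` are far apart. -/
theorem pairwise_starts (hr : 0 < r) (a : ℕ) :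
    {k : ℤ | ∃ j : ℕ, k = ((a + 4 * r * j : ℕ) : ℤ)}.Pairwise
      fun a a' => 2 * (r : ℤ) < |a - a'| := by
  rintro _ ⟨m, rfl⟩ _ ⟨m', rfl⟩ hne
  have h : (m : ℤ) - m' ≠ 0 := fun h => hne (by rw [show m = m' by omega])
  have h1 : (1 : ℤ) ≤ |(m : ℤ) - m'| := Int.one_le_abs h
  have h2 : ((a + 4 * r * m : ℕ) : ℤ) - ((a + 4 * r * m' : ℕ) : ℤ) = 4 * r * ((m : ℤ) - m') := by
    push_cast
    ring
  rw [h2, abs_mul, abs_of_nonneg (by positivity)]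
  nlinarith

/-- Algorithm `A`, executed simultaneously on a family of lines, informs all nodes within distance
`√3 r / 2` of the lines. -/
theorem mem_bcast_algA {j : Fin d} {T : LatticeNode d L → Prop} (hT : IsLineFamily r j T)
    {b : LatticeNode d L} (hb : T b) (hs : 1 ≤ s) (hsr : s + 1 < r) (hrL : 2 * r ≤ L)
    {c : ℕ} (hc : c < L) {I : Set (LatticeNode d L)} (hI : Known j b I c) {v : LatticeNode d L}
    (hv : 4 * ∑ l ∈ Finset.univ.erase j, ((b l : ℤ) - (v l : ℤ)) ^ 2 ≤ 3 * (r : ℤ) ^ 2) :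
    v ∈ bcast r s ((algA L r s c).map (onLines j T)) I := by
  have hr : 0 < r := by omega
  have hq : c % r < r := Nat.mod_lt _ hr
  simp only [algA, List.map_append, bcast_append]
  set I₁ := bcast r s ((sparsePart L r c).map (onLines j T)) I with hI₁
  set K₁ : Set ℤ := {k | ∃ j : ℕ, k = ((c % r + 4 * r * j : ℕ) : ℤ)} with hK₁
  set K₂ : Set ℤ := {k | ∃ j : ℕ, k = ((c % r + 2 * r + 4 * r * j : ℕ) : ℤ)} with hK₂
  set I₂ := bcast r s ((localScheme r s 1 K₁).map (onLines j T)) I₁ with hI₂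
  set I₃ := bcast r s ((localScheme r s 1 K₂).map (onLines j T)) I₂ with hI₃
  set I₄ := bcast r s ((localScheme r s (-1) {2 * (r : ℤ) - 1}).map (onLines j T)) I₃ with hI₄
  have h12 : I₁ ⊆ I₂ := subset_bcast _ _
  have h23 : I₂ ⊆ I₃ := subset_bcast _ _
  have h34 : I₃ ⊆ I₄ := subset_bcast _ _
  have hsparse : ∀ a : ℕ, a < L → a % r = c % r → Known j b I₁ a := fun a haL ha =>
    known_sparsePart hT hb (by omega) hc hI haL ha
  have hcover : ∀ D : ℕ, 4 * D ≤ 3 * r ^ 2 → ∃ μ : ℕ, 2 * μ ≤ r + 1 ∧ (D = 0 → μ = 0) ∧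
      (∀ v : LatticeNode d L,
        ∑ l ∈ Finset.univ.erase j, ((b l : ℤ) - (v l : ℤ)) ^ 2 = D →
        c % r + μ ≤ v j → v j + 2 * r < L + 1 + μ → v ∈ I₃) ∧
      (∀ v : LatticeNode d L,
        ∑ l ∈ Finset.univ.erase j, ((b l : ℤ) - (v l : ℤ)) ^ 2 = D →
        (v j : ℕ) + μ < 2 * r → Known j b I₃ (2 * (r : ℤ) - 1) → v ∈ I₄) ∧
      (∀ v : LatticeNode d L,
        ∑ l ∈ Finset.univ.erase j, ((b l : ℤ) - (v l : ℤ)) ^ 2 = D →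
        L + μ ≤ v j + 2 * r → Known j b I₄ ((L : ℤ) - 2 * r) →
          v ∈ bcast r s ((localScheme r s 1 {(L : ℤ) - 2 * (r : ℤ)}).map (onLines j T)) I₄) := by
    intro D hD
    obtain ⟨μ, hμ, hμ0, hloc⟩ := mem_bcast_localScheme hT hb hs hsr hD
    refine ⟨μ, hμ, hμ0, fun v hDv h1 h2 => ?_, fun v hDv h1 hkn => ?_, fun v hDv h1 hkn => ?_⟩
    -- The block number `m` selects the start `c % r + 2 * r * m`, informed by the sparse part. Its
    -- parity decides which parallel execution covers it, and the upper bound on `v j` makes all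
    -- `2r` labels of the block fit.
    · have h3 := Nat.div_add_mod (v j - (c % r + μ)) (2 * r)
      have h4 := Nat.mod_lt (v j - (c % r + μ)) (show 0 < 2 * r by omega)
      set m := (v j - (c % r + μ)) / (2 * r) with hm
      set ρ := (v j - (c % r + μ)) % (2 * r)
      have hkn : Known j b I₁ ((c % r + 2 * r * m : ℕ) : ℤ) :=
        hsparse _ (by omega) (by rw [mul_comm 2 r, mul_assoc, Nat.add_mul_mod_self_left,
          Nat.mod_mod])
      rcases Nat.even_or_odd' m with ⟨m', hm' | hm'⟩
      · have hmm : 2 * r * m = 4 * r * m' := by rw [hm']; ring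
        refine h23 (hloc 1 K₁ ((c % r + 2 * r * m : ℕ) : ℤ) I₁ (L - 1 - (c % r + 2 * r * m))
          (μ + ρ) v (Or.inl rfl) (pairwise_starts hr _) ⟨m', by rw [hmm]⟩ ?_ ?_ hkn
          ?_ ?_ ?_ ?_ ?_ ?_ ?_ hDv) <;> omega
      · have hmm : c % r + 2 * r * m = c % r + 2 * r + 4 * r * m' := by rw [hm']; ring
        refine hloc 1 K₂ ((c % r + 2 * r * m : ℕ) : ℤ) I₂ (L - 1 - (c % r + 2 * r * m))
          (μ + ρ) v (Or.inl rfl) (pairwise_starts hr _) ⟨m', by rw [hmm]⟩ ?_ ?_ (hkn.mono h12)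
          ?_ ?_ ?_ ?_ ?_ ?_ ?_ hDv <;> omega
    · refine hloc (-1) _ _ I₃ (2 * r - 1) (2 * r - 1 - v j) v (Or.inr rfl)
        (Set.pairwise_singleton _ _) rfl ?_ ?_ hkn ?_ ?_ ?_ ?_ ?_ ?_ ?_ hDv <;> omega
    · have := (v j).isLt
      refine hloc 1 _ _ I₄ (2 * r - 1) (v j - (L - 2 * r)) v (Or.inl rfl)
        (Set.pairwise_singleton _ _) rfl ?_ ?_ hkn ?_ ?_ ?_ ?_ ?_ ?_ ?_ hDv <;> omega
  have hleft : Known j b I₃ (2 * (r : ℤ) - 1) := by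
    -- Rounding up puts the sender `c % r + i * w` of the first block between `r - 1` and `r + w -
    -- 2`, hence at a distance from `s + 2` to `r` from `2r - 1`.
    obtain ⟨w, hw⟩ : ∃ w, r - (s + 1) = w := ⟨_, rfl⟩
    have h1 := Nat.div_mul_le_self (r - 1 - c % r + (w - 1)) w
    have h2 := Nat.lt_div_mul_add (a := r - 1 - c % r + (w - 1)) (show 0 < w by omega)
    have hx := le_ceilDiv_mul (r := r) (w := w) (by omega)
    set i := (r - 1 - c % r + (w - 1)) / w
    have hi : i ≤ r ⌈/⌉ w := by
      by_contra! h
      have := Nat.mul_le_mul_right w (Nat.succ_le_of_lt h)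
      rw [Nat.succ_mul] at this
      omega
    have hserved := (served_localScheme hT hb hsr (Or.inl rfl) (pairwise_starts hr (c % r))
      (k := ((c % r : ℕ) : ℤ)) ⟨0, by simp⟩ (by omega) (by omega)
      (hsparse _ (by omega) (Nat.mod_mod _ _)) (i := i) (by rwa [hw]) (fun m hm => by
        have := Nat.mul_le_mul_right w (Nat.succ_le_of_lt hm)
        rw [Nat.succ_mul] at this
        rw [hw]
        constructor <;> omega)).1
    rw [hw] at hserved
    exact (hserved.known (y := 2 * (r : ℤ) - 1) (by omega) (by omega) (by omega)
      (by omega)).mono h23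
  have hright : Known j b I₄ ((L : ℤ) - 2 * r) := by
    -- On the line itself the margin is `0`, so the blocks and the left termination reach label `L -
    -- 2r`.
    obtain ⟨μ, -, hμ0, hm, hl, -⟩ := hcover 0 (by simp)
    have hμ := hμ0 rfl
    intro u hu huj
    have hD : ∑ l ∈ Finset.univ.erase j, ((b l : ℤ) - (u l : ℤ)) ^ 2 = ((0 : ℕ) : ℤ) :=
      Finset.sum_eq_zero fun l hl => by rw [hu l (Finset.ne_of_mem_erase hl)]; simp
    by_cases h : (u j : ℕ) < 2 * r
    · exact hl u hD (by omega) hleft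
    · exact h34 (hm u hD (by omega) (by omega))
  have hnn : 0 ≤ ∑ l ∈ Finset.univ.erase j, ((b l : ℤ) - (v l : ℤ)) ^ 2 :=
    Finset.sum_nonneg fun _ _ => sq_nonneg _
  obtain ⟨D, hD⟩ := Int.eq_ofNat_of_zero_le hnn
  obtain ⟨μ, hμ, -, hm, hl, hr'⟩ := hcover D (by rw [hD] at hv; exact_mod_cast hv)
  -- The three ranges leave no gap: `c % r ≤ r - 1` and `2μ ≤ r + 1` give `c % r + μ ≤ 2r - μ`, and
  -- the middle range ends where the right one begins.
  by_cases h1 : (v j : ℕ) + μ < 2 * r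
  · exact subset_bcast _ _ (hl v hD h1 hleft)
  · by_cases h2 : L + μ ≤ v j + 2 * r
    · exact hr' v hD h2 hright
    · exact subset_bcast _ _ (h34 (hm v hD (by omega) (by omega)))

end LineAlgorithm

/-! ### The lines of a stage -/

/-- Keeps a node within the admissible offset when `j` transversal coordinates are each off by at
most the half gap. -/
theorem four_mul_halfGap_sq_le (r j : ℕ) : 4 * (j * halfGap r j ^ 2) ≤ 3 * r ^ 2 := by
  have h1 := Nat.sqrt_le' (3 * r ^ 2 / (4 * j))
  have h2 := Nat.mul_le_mul_left (4 * j) h1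
  have h3 := Nat.mul_div_le (3 * r ^ 2) (4 * j)
  rw [← mul_assoc, halfGap]
  omega

/-- The gap between consecutive lines of a stage, except for the last one, is large enough for
`3j` classes. -/
theorem two_mul_le_gap {r j : ℕ} (hr : 3 ≤ r) (hj : 1 ≤ j) :
    2 * r ≤ (3 * j - 1) * max 1 (2 * halfGap r j) := by
  have h1 := Nat.lt_succ_sqrt' (3 * r ^ 2 / (4 * j))
  rw [Nat.div_lt_iff_lt_mul (by omega), Nat.succ_eq_add_one] at h1
  change 3 * r ^ 2 < (halfGap r j + 1) ^ 2 * (4 * j) at h1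
  generalize halfGap r j = h at *
  obtain ⟨i, rfl⟩ : ∃ i, j = i + 1 := ⟨j - 1, by omega⟩
  rw [show 3 * (i + 1) - 1 = 3 * i + 2 by omega]
  rcases Nat.eq_zero_or_pos h with rfl | hh
  · simp only [mul_zero, zero_le, max_eq_left, mul_one]
    nlinarith
  · rw [max_eq_right (by omega)]
    by_contra! hlt
    rcases Nat.eq_zero_or_pos i with rfl | hi
    · nlinarith
    · have h2 : (3 * i + 2) * h + 1 ≤ r := by nlinarith
      have h3 : ((3 * i + 2) * h) ^ 2 ≤ r ^ 2 := Nat.pow_le_pow_left (by omega) 2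
      -- For `j ≥ 2` the crude `h + 1 ≤ 2h` suffices, as `16 * j ≤ 3 * (3 * j - 1) ^ 2`.
      have h4 : (h + 1) ^ 2 ≤ 4 * h ^ 2 := by nlinarith
      have h5 : (h + 1) ^ 2 * (4 * (i + 1)) ≤ 4 * h ^ 2 * (4 * (i + 1)) :=
        Nat.mul_le_mul_right _ h4
      have h6 : h ^ 2 * (16 * (i + 1)) ≤ h ^ 2 * (3 * (3 * i + 2) ^ 2) :=
        Nat.mul_le_mul_left _ (by nlinarith)
      nlinarith

/-- Different transversal coordinates of the same class are far apart. -/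
theorem two_mul_lt_abs_sub_of_mem_lineCoords {L r j e z z' : ℕ} (hr : 3 ≤ r) (hj : 1 ≤ j)
    (hz : z ∈ lineCoords L r j e) (hz' : z' ∈ lineCoords L r j e) (hne : z ≠ z') :
    2 * (r : ℤ) < |(z : ℤ) - z'| := by
  wlog h : z < z' generalizing z z'
  · rw [abs_sub_comm]
    exact this hz' hz hne.symm (by omega)
  obtain ⟨m, hm, hmL, rfl⟩ := hz
  obtain ⟨m', hm', hmL', rfl⟩ := hz'
  have hgap := two_mul_le_gap hr hj
  have ht : 1 ≤ max 1 (2 * halfGap r j) := le_max_left _ _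
  generalize max 1 (2 * halfGap r j) = t at *
  have hlt : m < m' := by
    by_contra! hle
    have := Nat.mul_le_mul_left t hle
    omega
  obtain ⟨q, hq⟩ := (Nat.modEq_iff_dvd' hlt.le).1 (hm.trans hm'.symm)
  have hq0 : 1 ≤ q := by
    rcases q with - | q <;> omega
  have h1 : 3 * j * 1 ≤ 3 * j * q := Nat.mul_le_mul_left _ hq0
  -- Indices of one class differ by at least `3j`. Clipping the last value to `L - 1` costs less
  -- than one gap `t`, hence the factor `3j - 1`.
  have h2 : t * (m + 3 * j) ≤ t * m' := Nat.mul_le_mul_left t (by omega)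
  have h3 : t * (m + 3 * j) = t * m + (3 * j - 1) * t + t := by
    obtain ⟨i, hi⟩ : ∃ i, 3 * j = i + 1 := ⟨3 * j - 1, by omega⟩
    rw [hi, Nat.add_sub_cancel]
    ring
  rw [abs_sub_comm, abs_of_nonneg (by omega)]
  omega

/-- Every coordinate is within `halfGap r j` of a transversal coordinate of some class. -/
theorem exists_mem_lineCoords {L j z : ℕ} (r : ℕ) (hj : 1 ≤ j) (hz : z < L) :
    ∃ e < 3 * j, ∃ z' < L, z' ∈ lineCoords L r j e ∧
      ((z' : ℤ) - z) ^ 2 ≤ (halfGap r j : ℤ) ^ 2 := by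
  have ht : 0 < max 1 (2 * halfGap r j) := by omega
  have h1 := Nat.div_add_mod z (max 1 (2 * halfGap r j))
  have h2 := Nat.mod_lt z ht
  -- The line at the centre of the cell of `z` is taken; since `z ≤ L - 1`, clipping its coordinate
  -- only brings it closer.
  refine ⟨_, Nat.mod_lt (z / max 1 (2 * halfGap r j)) (by omega), _, ?_,
    ⟨z / max 1 (2 * halfGap r j), rfl, ?_, rfl⟩, sq_le_sq' ?_ ?_⟩
  all_goals omega

theorem exists_digits {j B : ℕ} (f : Fin j → ℕ) (hf : ∀ l, f l < B) :
    ∃ e < B ^ j, ∀ l : Fin j, e / B ^ (l : ℕ) % B = f l := by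
  refine ⟨_, (finFunctionFinEquiv fun l => (⟨f l, hf l⟩ : Fin B)).isLt, fun l => ?_⟩
  have := congrArg Fin.val (congrFun
    (finFunctionFinEquiv.symm_apply_apply fun l => (⟨f l, hf l⟩ : Fin B)) l)
  simpa [finFunctionFinEquiv] using this

/-! ### Correctness of Algorithm `A^d` -/

section Stages

variable {d L : ℕ} {r s : ℕ}

/-- The lines of a phase of stage `j`. -/
def phaseLine (r : ℕ) (src : LatticeNode d L) (j : Fin d) (e : ℕ) (v : LatticeNode d L) : Prop :=
  (∀ l : Fin d, l < j →
    ((v l : ℕ) ∈ lineCoords L r j (e / (3 * (j : ℕ)) ^ (l : ℕ) % (3 * (j : ℕ))))) ∧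
    ∀ l : Fin d, j < l → v l = src l

/-- The rounds of stage `j`. -/
def stage (r s : ℕ) (src : LatticeNode d L) (j : Fin d) : List (Set (LatticeNode d L)) :=
  (List.range ((3 * (j : ℕ)) ^ (j : ℕ))).flatMap fun e =>
    (algA L r s (src j)).map (onLines j (phaseLine r src j e))

theorem algAd_eq_flatMap_stage (src : LatticeNode d L) :
    algAd d L r s src = (List.finRange d).flatMap (stage r s src) := rfl

/-- Distinct lines of a phase differ in some coordinate before `j`, where both values belong to the
same class and are thus more than `2r` apart. -/
theorem isLineFamily_phaseLine (hr : 3 ≤ r) (src : LatticeNode d L) (j : Fin d) (e : ℕ) :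
    IsLineFamily r j (phaseLine r src j e) where
  mem_of_agree u b h hb :=
    ⟨fun l hl => by rw [h l hl.ne]; exact hb.1 l hl, fun l hl => by rw [h l hl.ne']; exact hb.2 l hl⟩
  agree_or_far u u' hu hu' := by
    by_cases h : ∀ l < j, u l = u' l
    · refine Or.inl fun l hl => ?_
      rcases lt_or_gt_of_ne hl with h' | h'
      · exact h l h'
      · rw [hu.2 l h', hu'.2 l h']
    · push Not at h
      obtain ⟨l, hl, hne⟩ := h
      refine Or.inr (two_mul_lt_dist_pos (l := l) ?_)
      exact two_mul_lt_abs_sub_of_mem_lineCoords hr (by have : (l : ℕ) < j := hl; omega)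
        (hu.1 l hl) (hu'.1 l hl) fun h => hne (Fin.ext h)

/-- Every node of the sublattice of stage `j` is within distance `√3 r / 2` of a line of some
phase. -/
theorem exists_phaseLine_near (r : ℕ) (src : LatticeNode d L) (j : Fin d) {v : LatticeNode d L}
    (hv : ∀ l, j < l → v l = src l) :
    ∃ e < (3 * (j : ℕ)) ^ (j : ℕ), ∃ b, phaseLine r src j e b ∧
      4 * ∑ l ∈ Finset.univ.erase j, ((b l : ℤ) - (v l : ℤ)) ^ 2 ≤ 3 * (r : ℤ) ^ 2 := by
  have hex : ∀ l : Fin j, ∃ f < 3 * (j : ℕ), ∃ z < L, z ∈ lineCoords L r j f ∧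
      ((z : ℤ) - (v ⟨l, by omega⟩ : ℕ)) ^ 2 ≤ (halfGap r j : ℤ) ^ 2 := fun l =>
    exists_mem_lineCoords r (by have := l.isLt; omega) (v ⟨l, by omega⟩).isLt
  choose f hf z hzL hz hzv using hex
  obtain ⟨e, he, hdig⟩ := exists_digits f hf
  let b : LatticeNode d L := fun l => if h : (l : ℕ) < j then ⟨z ⟨l, h⟩, hzL _⟩ else v l
  have hb1 : ∀ l : Fin d, ∀ h : (l : ℕ) < j, (b l : ℕ) = z ⟨l, h⟩ := fun l h => by
    simp only [b, dif_pos h]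
  have hb2 : ∀ l : Fin d, ¬ (l : ℕ) < j → b l = v l := fun l h => dif_neg h
  refine ⟨e, he, b, ⟨fun l hl => ?_, fun l hl => ?_⟩, ?_⟩
  · have hl' : (l : ℕ) < j := hl
    rw [hb1 l hl', hdig ⟨l, hl'⟩]
    exact hz ⟨l, hl'⟩
  · have hl' : (j : ℕ) < l := hl
    rw [hb2 l (by omega), hv l hl]
  · have hsum : ∑ l ∈ Finset.univ.erase j, ((b l : ℤ) - (v l : ℤ)) ^ 2 ≤
        ∑ l ∈ Finset.Iio j, (halfGap r j : ℤ) ^ 2 := by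
      have : Finset.Iio j ⊆ Finset.univ.erase j := fun l hl => by
        simp only [Finset.mem_erase, Finset.mem_univ, and_true]
        exact (Finset.mem_Iio.1 hl).ne
      rw [← Finset.sum_subset this fun l _ hl => ?_]
      · refine Finset.sum_le_sum fun l hl => ?_
        have hl' : l < j := Finset.mem_Iio.1 hl
        rw [hb1 l hl']
        exact hzv ⟨l, hl'⟩
      · rw [hb2 l fun h => hl (Finset.mem_Iio.2 h)]
        simp
    rw [Finset.sum_const, Fin.card_Iio, nsmul_eq_mul] at hsum
    have := four_mul_halfGap_sq_le r j
    zify at this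
    linarith

/-- Every line of a phase meets the sublattice informed by earlier stages at coordinate `src j`, so
`A` can start on it. Only the phase with a line near `v` matters; the others never remove
information. -/
theorem mem_bcast_stage (hs : 1 ≤ s) (hsr : s + 1 < r) (hrL : 2 * r ≤ L)
    {src : LatticeNode d L} {j : Fin d} {I : Set (LatticeNode d L)}
    (hI : ∀ v : LatticeNode d L, (∀ l, j ≤ l → v l = src l) → v ∈ I) {v : LatticeNode d L}
    (hv : ∀ l, j < l → v l = src l) : v ∈ bcast r s (stage r s src j) I := by
  obtain ⟨e, he, b, hb, hbv⟩ := exists_phaseLine_near r src j hv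
  obtain ⟨l₁, l₂, hl⟩ := List.append_of_mem (List.mem_range.2 he)
  rw [stage, hl, List.flatMap_append, List.flatMap_cons, bcast_append, bcast_append]
  refine subset_bcast _ _ (mem_bcast_algA (isLineFamily_phaseLine (by omega) src j e) hb hs hsr
    hrL (src j).isLt (fun u hu huj => subset_bcast _ _ (hI u fun l hl => ?_)) hbv)
  rcases hl.lt_or_eq with h | rfl
  · rw [hu l h.ne', hb.2 l h]
  · exact Fin.ext (by exact_mod_cast huj)

theorem mem_informed_algAd (hs : 1 ≤ s) (hsr : s + 1 < r) (hrL : 2 * r ≤ L)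
    (src v : LatticeNode d L) :
    v ∈ informed r s (algAd d L r s src) src (algAd d L r s src).length := by
  rw [informed_length, algAd_eq_flatMap_stage]
  have key : ∀ n ≤ d, ∀ v : LatticeNode d L, (∀ l : Fin d, n ≤ l → v l = src l) →
      v ∈ bcast r s (((List.finRange d).take n).flatMap (stage r s src)) {src} := by
    intro n
    induction n with
    | zero => exact fun _ v hv => funext fun l => hv l (Nat.zero_le _)
    | succ n ih =>
      intro hn v hv
      have hlt : n < (List.finRange d).length := by rw [List.length_finRange]; exact hn
      rw [← List.take_concat_get' _ _ hlt, List.flatMap_append, List.flatMap_singleton,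
        bcast_append, List.getElem_finRange]
      exact mem_bcast_stage hs hsr hrL (fun u hu => ih (by omega) u fun l hl => hu l hl)
        fun l hl => hv l hl
  have := key d le_rfl v fun l hl => absurd l.isLt (by omega)
  rwa [List.take_of_length_le (by rw [List.length_finRange])] at this

end Stages

/-! ### The number of rounds -/

section Rounds

variable {d L : ℕ} {r s : ℕ}

theorem length_localScheme (ε : ℤ) (K : Set ℤ) :
    (localScheme r s ε K).length = 2 * (r ⌈/⌉ (r - (s + 1)) + 1) := by
  simp [localScheme, List.length_flatMap, mul_comm]

/-- The count is at most `L/r + 1 + 8(r/w + 2)`, and `1 ≤ r/w` absorbs the constant `17` into `25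
r/w`. -/
theorem length_algA_le (hsr : s + 1 < r) {c : ℕ} (hc : c < L) :
    ((algA L r s c).length : ℝ) ≤ 25 * ((L : ℝ) / r + r / ((r : ℝ) - (s + 1))) := by
  obtain ⟨w, rfl⟩ : ∃ w, r = s + 1 + w := ⟨r - (s + 1), by omega⟩
  have hw : s + 1 + w - (s + 1) = w := by omega
  have hw' : ((s + 1 + w : ℕ) : ℝ) - (s + 1) = w := by push_cast; ring
  have hw0 : (0 : ℝ) < w := by exact_mod_cast (by omega : 0 < w)
  have hlen : (algA L (s + 1 + w) s c).length =
      (L - 1 - c) / (s + 1 + w) + 1 + c / (s + 1 + w) + 8 * ((s + 1 + w) ⌈/⌉ w + 1) := by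
    simp only [algA, sparsePart, List.length_append, length_localScheme, List.length_map,
      List.length_range, hw]
    ring
  rw [hlen, hw']
  set r := s + 1 + w with hr
  have hr0 : (0 : ℝ) < r := by exact_mod_cast (by omega : 0 < r)
  have h1 : (((L - 1 - c) / r : ℕ) : ℝ) + ((c / r : ℕ) : ℝ) ≤ (L : ℝ) / r := by
    have h2 := Nat.div_mul_le_self (L - 1 - c) r
    have h3 := Nat.div_mul_le_self c r
    rw [le_div_iff₀ hr0, add_mul]
    exact_mod_cast (by omega : (L - 1 - c) / r * r + c / r * r ≤ L)
  have h2 : ((r ⌈/⌉ w : ℕ) : ℝ) ≤ (r : ℝ) / w + 1 := by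
    have := ceilDiv_mul_lt (r := r) (w := w) (by omega) (by omega)
    rw [div_add_one hw0.ne', le_div_iff₀ hw0]
    exact_mod_cast this.le
  have h3 : (1 : ℝ) ≤ (r : ℝ) / w := by
    rw [one_le_div hw0]
    exact_mod_cast (by omega : w ≤ r)
  have h4 : (0 : ℝ) ≤ (L : ℝ) / r := by positivity
  push_cast
  linarith

theorem length_algAd_le (hsr : s + 1 < r) (src : LatticeNode d L) :
    ((algAd d L r s src).length : ℝ) ≤
      25 * (3 * d) ^ d * (d * ((L : ℝ) / r + r / ((r : ℝ) - (s + 1)))) := by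
  have hB : ∀ j : Fin d, ((stage r s src j).length : ℝ) ≤
      (3 * d) ^ d * (25 * ((L : ℝ) / r + r / ((r : ℝ) - (s + 1)))) := fun j => by
    have hlen : (stage r s src j).length =
        (3 * (j : ℕ)) ^ (j : ℕ) * (algA L r s (src j)).length := by
      simp [stage, List.length_flatMap]
    rw [hlen, Nat.cast_mul]
    refine mul_le_mul ?_ (length_algA_le hsr (src j).isLt) (Nat.cast_nonneg _) (by positivity)
    have hj := j.isLt
    have h1 : (3 * (j : ℕ)) ^ (j : ℕ) ≤ (3 * d) ^ (j : ℕ) := Nat.pow_le_pow_left (by omega) _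
    have h2 : (3 * d) ^ (j : ℕ) ≤ (3 * d) ^ d := Nat.pow_le_pow_right (by omega) hj.le
    exact_mod_cast h1.trans h2
  have hsum : (algAd d L r s src).length = ∑ j : Fin d, (stage r s src j).length := by
    rw [algAd_eq_flatMap_stage, List.length_flatMap, Fin.sum_univ_def]
  rw [hsum, Nat.cast_sum]
  refine (Finset.sum_le_sum fun j _ => hB j).trans (le_of_eq ?_)
  rw [Finset.sum_const, Finset.card_univ, Fintype.card_fin, nsmul_eq_mul]
  ring

/-- The message needs time to traverse the lattice. -/
theorem le_four_mul_of_forall_mem_informed (hd : 1 ≤ d) (hL : 2 ≤ L)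
    {sched : List (Set (LatticeNode d L))} {src : LatticeNode d L} {t : ℕ}
    (h : ∀ v, v ∈ informed r s sched src t) : L ≤ 4 * (t * r) := by
  have h1 := abs_sub_le_of_mem_informed (h fun _ => ⟨0, by omega⟩) ⟨0, hd⟩
  have h2 := abs_sub_le_of_mem_informed (h fun _ => ⟨L - 1, by omega⟩) ⟨0, hd⟩
  have h3 := (src ⟨0, hd⟩).isLt
  zify
  rw [abs_le] at h1 h2
  simp only at h1 h2
  generalize (t : ℤ) * r = z at *
  omega

/-- The sparse transmission and the first `t` steps of `Local*` make up the beginning of Algorithm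
`A^d`. -/
theorem exists_algAd_eq_append [NeZero d] (src : LatticeNode d L) {t : ℕ}
    (ht : t ≤ r ⌈/⌉ (r - (s + 1)) + 1) :
    ∃ rest, algAd d L r s src =
      (sparsePart L r (src 0) ++ (List.range t).flatMap fun i =>
        [{y | ∃ k ∈ {k : ℤ | ∃ j : ℕ, k = (((src 0 : ℕ) % r + 4 * r * j : ℕ) : ℤ)},
            y = k + 1 * ((i * (r - (s + 1)) : ℕ) : ℤ)},
          {y | ∃ k ∈ {k : ℤ | ∃ j : ℕ, k = (((src 0 : ℕ) % r + 4 * r * j : ℕ) : ℤ)},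
            y = k + 1 * ((i * (r - (s + 1)) + r : ℕ) : ℤ)}]).map
        (onLines 0 (phaseLine r src 0 0)) ++ rest := by
  obtain ⟨n, rfl⟩ : ∃ n, d = n + 1 := ⟨d - 1, by have := NeZero.pos d; omega⟩
  obtain ⟨m, hm⟩ : ∃ m, r ⌈/⌉ (r - (s + 1)) + 1 = t + m := ⟨_, (Nat.add_sub_of_le ht).symm⟩
  rw [algAd_eq_flatMap_stage, List.finRange_succ, List.flatMap_cons]
  have hst : stage r s src 0 = (algA L r s (src 0)).map (onLines 0 (phaseLine r src 0 0)) := by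
    simp [stage]
  rw [hst, algA]
  conv =>
    enter [1, rest, 1, 1, 2, 1, 1, 1, 2]
    rw [localScheme, hm, List.range_add, List.flatMap_append]
  simp only [List.map_append, List.append_assoc]
  exact ⟨_, rfl⟩

/-- The node with label `c % r + s` on the line of the source gets the message late. -/
theorem le_add_one_mul_of_forall_mem_informed [NeZero d] (hs : 1 ≤ s) (hsr : s + 1 < r)
    (hrL : 2 * r ≤ L) {src : LatticeNode d L} {t : ℕ}
    (h : ∀ v, v ∈ informed r s (algAd d L r s src) src t) :
    s ≤ (t + 1) * (r - (s + 1)) := by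
  by_contra! hlt
  obtain ⟨w, hw⟩ : ∃ w, r - (s + 1) = w := ⟨_, rfl⟩
  have hw1 : 1 ≤ w := by omega
  rw [hw, add_mul, one_mul] at hlt
  -- A larger `t` would force `t * w ≥ r > s`. So the first `t` rounds lie within the sparse part
  -- and `t` steps of `Local*`.
  have htx : t ≤ r ⌈/⌉ (r - (s + 1)) + 1 := by
    rw [hw]
    by_contra! hc
    have h1 := Nat.mul_le_mul_right w hc.le
    have h2 := le_ceilDiv_mul (r := r) hw1
    rw [add_mul] at h1
    omega
  obtain ⟨rest, hrest⟩ := exists_algAd_eq_append (r := r) (s := s) src htx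
  have hq : (src 0 : ℕ) % r < r := Nat.mod_lt _ (by omega)
  obtain ⟨z, hz, hz0⟩ := exists_node_on_line (0 : Fin d) src
    (a := (((src 0 : ℕ) % r + s : ℕ) : ℤ)) (by omega) (by omega)
  have hz0' : (z 0 : ℕ) = (src 0 : ℕ) % r + s := by exact_mod_cast hz0
  have hz' := h z
  have hlen : t ≤ (sparsePart L r (src 0) ++ (List.range t).flatMap fun i =>
        [{y | ∃ k ∈ {k : ℤ | ∃ j : ℕ, k = (((src 0 : ℕ) % r + 4 * r * j : ℕ) : ℤ)},
            y = k + 1 * ((i * (r - (s + 1)) : ℕ) : ℤ)},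
          {y | ∃ k ∈ {k : ℤ | ∃ j : ℕ, k = (((src 0 : ℕ) % r + 4 * r * j : ℕ) : ℤ)},
            y = k + 1 * ((i * (r - (s + 1)) + r : ℕ) : ℤ)}]).length := by
    simp [List.length_flatMap]
    omega
  rw [informed_eq_bcast _ _ (by rw [hrest, List.length_append, List.length_map]; omega), hrest,
    List.take_append_of_le_length (by rwa [List.length_map])] at hz'
  refine notMem_bcast_of_not_adj ?_ ?_ hz'
  · intro he
    have he' : z = src := he
    rw [he'] at hz0'
    have : ((src 0 : ℕ) % r + s) % r = (src 0 : ℕ) % r := by rw [← hz0']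
    rcases lt_or_ge ((src 0 : ℕ) % r + s) r with h1 | h1
    · rw [Nat.mod_eq_of_lt h1] at this
      omega
    · rw [Nat.mod_eq_sub_mod h1, Nat.mod_eq_of_lt (by omega)] at this
      omega
  · intro X hX u hu hadj
    obtain ⟨S, hS, rfl⟩ := List.mem_map.1 (List.mem_of_mem_take hX)
    have hus : ∀ l, l ≠ 0 → u l = z l := fun l hl => by
      rw [hz l hl]
      exact hu.2.2 l (Fin.pos_iff_ne_zero.2 hl)
    have h1 := (lt_dist_pos_iff u z s).1 hadj.1
    have h2 := abs_sub_le_of_dist_pos_le hadj.2 0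
    rw [sqDist_eq_of_forall_ne hus, sq_lt_sq, abs_of_nonneg (by positivity)] at h1
    have hu0 := hu.1
    rw [hz0] at h1 h2
    -- Relative to `c % r`, senders at `0` and `i * w` are within `s` of label `s`; those at `r + i
    -- * w` are at distance `(i + 1) * w + 1 ≤ s`. The remaining senders are beyond `r`.
    rcases List.mem_append.1 hS with hS | hS
    · have hlabel : ∃ m : ℕ, (u 0 : ℕ) = (src 0 : ℕ) % r + r * m := by
        have hdm := Nat.mod_add_div (src 0 : ℕ) r
        rcases List.mem_append.1 hS with hS | hS
        · obtain ⟨m, -, rfl⟩ := List.mem_map.1 hS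
          have hu' : ((u 0 : ℕ) : ℤ) = (((src 0 : ℕ) + m * r : ℕ) : ℤ) := hu0
          exact ⟨(src 0 : ℕ) / r + m, by rw [mul_add, mul_comm r m]; omega⟩
        · obtain ⟨m, hm, rfl⟩ := List.mem_map.1 hS
          have hu' : ((u 0 : ℕ) : ℤ) = (src 0 : ℕ) - (((m + 1) * r : ℕ) : ℤ) := hu0
          refine ⟨(src 0 : ℕ) / r - (m + 1), ?_⟩
          rw [Nat.mul_sub, mul_comm r (m + 1)]
          have := Nat.mul_le_mul_right r (Nat.succ_le_of_lt (List.mem_range.1 hm))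
          rw [mul_comm ((src 0 : ℕ) / r) r, Nat.succ_eq_add_one] at this
          omega
      obtain ⟨m, hm⟩ := hlabel
      rw [lt_abs] at h1
      rw [abs_le] at h2
      rcases m with - | - | m
      · omega
      · omega
      · rw [mul_add, mul_add] at hm
        omega
    · obtain ⟨i, hi, hS⟩ := List.mem_flatMap.1 hS
      have hiw := Nat.mul_le_mul_right w (Nat.succ_le_of_lt (List.mem_range.1 hi))
      rw [Nat.succ_mul] at hiw
      simp only [List.mem_cons, List.not_mem_nil, or_false, hw] at hS
      rw [lt_abs] at h1
      rw [abs_le] at h2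
      rcases hS with rfl | rfl
      all_goals
        obtain ⟨_, ⟨m, rfl⟩, hm⟩ := hu0
        rcases m with - | m
        · omega
        · rw [mul_add] at hm
          omega

end Rounds

theorem mainTheorem6 (d : ℕ) (hd : 1 ≤ d) :
    ∃ c C : ℝ, 0 < c ∧ 0 < C ∧
      ∀ n L r s : ℕ, n = L ^ d → 1 ≤ s → s + 1 < r → 2 * r ≤ L →
        ∀ src : LatticeNode d L,
          -- at the end of the algorithm every node has received the message
          (∀ v, v ∈ informed r s (algAd d L r s src) src (algAd d L r s src).length) ∧
          -- upper bound on the number of rounds of the algorithm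
          ((algAd d L r s src).length : ℝ) ≤
            C * (d * (n : ℝ) ^ (1 / (d : ℝ)) / r + d * (r : ℝ) / ((r : ℝ) - (s + 1))) ∧
          -- lower bound on every number of rounds after which all nodes have received the message
          ∀ t : ℕ, (∀ v, v ∈ informed r s (algAd d L r s src) src t) →
            c * (d * (n : ℝ) ^ (1 / (d : ℝ)) / r + d * (r : ℝ) / ((r : ℝ) - (s + 1))) ≤ (t : ℝ) := by
  have : NeZero d := ⟨by omega⟩
  have hd0 : (0 : ℝ) < d := by exact_mod_cast hd
  -- The `10` is `4 + 6`, from `L/r ≤ 4t` and `r/w ≤ 6t`; `(3d)^d` bounds the number of phases of a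
  -- stage.
  refine ⟨1 / (10 * d), 25 * (3 * d) ^ d, by positivity, by positivity, ?_⟩
  rintro n L r s rfl hs hsr hrL src
  have hroot : ((L ^ d : ℕ) : ℝ) ^ (1 / (d : ℝ)) = L := by
    rw [Nat.cast_pow, one_div]
    exact Real.pow_rpow_inv_natCast (Nat.cast_nonneg L) (by omega)
  have hfac : (d : ℝ) * L / r + d * (r : ℝ) / ((r : ℝ) - (s + 1)) =
      d * ((L : ℝ) / r + r / ((r : ℝ) - (s + 1))) := by ring
  rw [hroot, hfac]
  refine ⟨mem_informed_algAd hs hsr hrL src, length_algAd_le hsr src, fun t ht => ?_⟩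
  have h1 := le_four_mul_of_forall_mem_informed hd (by omega) ht
  have h2 := le_add_one_mul_of_forall_mem_informed hs hsr hrL ht
  obtain ⟨w, rfl⟩ : ∃ w, r = s + 1 + w := ⟨r - (s + 1), by omega⟩
  rw [show s + 1 + w - (s + 1) = w by omega] at h2
  have hw' : ((s + 1 + w : ℕ) : ℝ) - (s + 1) = w := by push_cast; ring
  have hw0 : (0 : ℝ) < w := by exact_mod_cast (by omega : 0 < w)
  have hr0 : (0 : ℝ) < ((s + 1 + w : ℕ) : ℝ) := by positivity
  have ht1 : 1 ≤ t := by
    rcases Nat.eq_zero_or_pos t with rfl | h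
    · omega
    · exact h
  rw [hw']
  have h3 : (L : ℝ) / ((s + 1 + w : ℕ) : ℝ) ≤ 4 * t := by
    rw [div_le_iff₀ hr0]
    exact_mod_cast (by rw [mul_assoc]; exact h1 : L ≤ 4 * t * (s + 1 + w))
  have h4 : ((s + 1 + w : ℕ) : ℝ) / w ≤ 6 * t := by
    rw [div_le_iff₀ hw0]
    have : s + 1 + w ≤ 6 * t * w := by
      nlinarith
    exact_mod_cast this
  rw [div_mul_eq_mul_div, one_mul, div_le_iff₀ (by positivity)]
  nlinarith
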